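/- Let $p>1$, let $\mathcal X\subset\mathbb R^d$ be a discrete set, and let $\phi:\mathbb R^d\times\mathbb R^q\to\mathbb R$ be continuous; write $\phi^\theta=\phi(\cdot,\theta)$. Let $\mathcal P(\mathcal X)$ be the set of probability measures $\sum_{i=1}^n a_i\delta_{x_i}$ with finitely many points $x_i\in\mathcal X$ and weights $a_i\ge 0$, $\sum_i a_i=1$. For measures given in such a form, $\mu=\sum_{i=1}^n a_i\delta_{x_i}$ and $\nu=\sum_{j=1}^m b_j\delta_{y_j}$, put $C_{\mu\nu}=(\|x_i-y_j\|_p^p)_{i,j}$, $U(a,b)=\{\pi\in\mathbb R_{\ge 0}^{n\times m}:\pi 1_m=a,\ \pi^\top 1_n=b\}$, and $W_p^p(\mu,\nu)=\min_{\pi\in U(a,b)}\langle C_{\mu\nu},\pi\rangle$, where $\langle\cdot,\cdot\rangle$ is the entrywise inner product of matrices. For all $\mu,\nu$ and $\theta\in\mathbb R^q$ let $$\pi^\theta=\pi^\theta(\mu,\nu)\in\arg\min_{\pi\in U(a,b)}\ \sum_{i,j}\pi_{i,j}\,|\phi(x_i,\theta)-\phi(y_j,\theta)|^p$$ be a choice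 of minimizer that is measurable in $\theta$, and let $h(\theta)=h(\theta)(\mu,\nu)=\langle C_{\mu\nu},\pi^\theta(\mu,\nu)\rangle$. For $\varepsilon>0$ and $Z\sim\mathcal N(0,\mathrm{Id}_q)$ let $$\pi_\varepsilon^\theta=\mathbb E\big[\pi^{\theta+\varepsilon Z}\big],\qquad h_\varepsilon(\theta)=\mathbb E\big[h(\theta+\varepsilon Z)\big]=\langle C_{\mu\nu},\pi_\varepsilon^\theta\rangle .$$ Let $\mu,\nu\in\mathcal P(\mathcal X)$ be such that there is an open set $C\subseteq\mathbb R^q$ with $\mathcal H^{q-1}(\mathbb R^q\setminus C)=0$, where $\mathcal H^{q-1}$ is the $(q-1)$-dimensional Hausdorff measure, on which $\theta\mapsto h(\theta)(\mu,\nu)$ is continuously differentiable. Then: 1. (Admissibility.) For all $\varepsilon>0$ and $\theta\in\mathbb R^q$, $\pi_\varepsilon^\theta\in U(a,b)$; hence $h_\varepsilon(\theta)\ge W_p^p(\mu,\nu)$. 2. (Differentiability.) For all $\varepsilon>0$, the map $h_\varepsilon$ is differentiable on $\mathbb R^q$, and $\nabla h_\varepsilon(\theta)=\varepsilon^{-1}\,\mathbb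 E[h(\theta+\varepsilon Z)\,Z]$ for all $\theta$. 3. (Consistency.) For almost every $\theta\in\mathbb R^q$, $\lim_{\varepsilon\to0^+}h_\varepsilon(\theta)=h(\theta)$; and $\lim_{\varepsilon\to0^+}\nabla h_\varepsilon(\theta)=\nabla h(\theta)$ at every $\theta$ at which $h$ is differentiable. Moreover (this part does not need the regularity assumption on $h$): 4. (Distance.) If $\theta\in\mathbb R^q$ and $\phi^\theta$ is injective on $\mathcal X$, then $(\mu,\nu)\mapsto(h(\theta)(\mu,\nu))^{1/p}$ is a (well-defined) distance on $\mathcal P(\mathcal X)$. If $\phi^\theta$ is injective on $\mathcal X$ for almost every $\theta\in\mathbb R^q$, then for all $\varepsilon>0$ and $\theta\in\mathbb R^q$, $(\mu,\nu)\mapsto(h_\varepsilon(\theta)(\mu,\nu))^{1/p}$ is a (well-defined) distance on $\mathcal P(\mathcal X)$. -/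

import Mathlib

open MeasureTheory ProbabilityTheory Filter Topology

noncomputable section

namespace GSWP

/-- A weighted point cloud in `X ⊆ ℝ^d`: points `x_1, …, x_n ∈ X` (repetitions allowed) with
nonnegative weights `a_1, …, a_n` of total mass one. It represents the discrete probability
measure `∑ a_i δ_{x_i}`. -/
structure PointCloud {d : ℕ} (X : Set (Fin d → ℝ)) where
  /-- the number of points -/
  n : ℕ
  /-- the points -/
  pt : Fin n → (Fin d → ℝ)
  pt_mem : ∀ i, pt i ∈ X
  /-- the weights -/
  wt : Fin n → ℝ
  wt_nonneg : ∀ i, 0 ≤ wt i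
  sum_wt : ∑ i, wt i = 1

variable {d q : ℕ} {X : Set (Fin d → ℝ)}

/-- The measure `∑ a_i δ_{x_i}` on `ℝ^d`. -/
def PointCloud.toMeasure (μ : PointCloud X) : Measure (Fin d → ℝ) :=
  ∑ i, ENNReal.ofReal (μ.wt i) • Measure.dirac (μ.pt i)

/-- `𝒫(X)`: the measures of the form `∑ a_i δ_{x_i}` with finitely many `x_i ∈ X`, `a_i ≥ 0` and
`∑ a_i = 1`. -/
def DiscreteMeasures (X : Set (Fin d → ℝ)) : Set (Measure (Fin d → ℝ)) :=
  Set.range (PointCloud.toMeasure (X := X))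

/-- The element of `𝒫(X)` represented by a point cloud. -/
def PointCloud.toDiscrete (μ : PointCloud X) : DiscreteMeasures X :=
  ⟨μ.toMeasure, μ, rfl⟩

/-- The coupling polytope `U(a,b)`: nonnegative matrices with row sums `a` and column sums `b`. -/
def couplings {n m : ℕ} (a : Fin n → ℝ) (b : Fin m → ℝ) : Set (Matrix (Fin n) (Fin m) ℝ) :=
  {P | (∀ i j, 0 ≤ P i j) ∧ (∀ i, ∑ j, P i j = a i) ∧ (∀ j, ∑ i, P i j = b j)}

/-- The matrix pairing `⟨C, P⟩ = ∑_{i,j} C_{ij} P_{ij}`. -/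
def pairing {n m : ℕ} (C P : Matrix (Fin n) (Fin m) ℝ) : ℝ :=
  ∑ i, ∑ j, C i j * P i j

/-- The cost matrix `(C_{μν})_{ij} = ‖x_i - y_j‖_p^p = ∑_k |x_{i,k} - y_{j,k}|^p`. -/
def costMatrix (p : ℝ) (μ ν : PointCloud X) : Matrix (Fin μ.n) (Fin ν.n) ℝ :=
  Matrix.of fun i j => ∑ k, |μ.pt i k - ν.pt j k| ^ p

/-- `W_p^p(μ,ν)`, the optimal value of the transport problem between `μ` and `ν` in `ℝ^d` for the
cost `‖x - y‖_p^p`. (The infimum is over a nonempty compact set.) -/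
def wassersteinPow (p : ℝ) (μ ν : PointCloud X) : ℝ :=
  sInf (pairing (costMatrix p μ ν) '' couplings μ.wt ν.wt)

/-- `g(P, θ) = ∑_{i,j} P_{ij} |φ(x_i, θ) - φ(y_j, θ)|^p`. -/
def projCost (p : ℝ) (φ : (Fin d → ℝ) → EuclideanSpace ℝ (Fin q) → ℝ) (μ ν : PointCloud X)
    (P : Matrix (Fin μ.n) (Fin ν.n) ℝ) (θ : EuclideanSpace ℝ (Fin q)) : ℝ :=
  pairing (Matrix.of fun i j => |φ (μ.pt i) θ - φ (ν.pt j) θ| ^ p) P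

/-- `P` is a `θ`-generalized sliced Wasserstein plan: `P ∈ argmin_{P' ∈ U(a,b)} g(P', θ)`. -/
def IsPlan (p : ℝ) (φ : (Fin d → ℝ) → EuclideanSpace ℝ (Fin q) → ℝ) (μ ν : PointCloud X)
    (θ : EuclideanSpace ℝ (Fin q)) (P : Matrix (Fin μ.n) (Fin ν.n) ℝ) : Prop :=
  P ∈ couplings μ.wt ν.wt ∧ IsMinOn (fun P' => projCost p φ μ ν P' θ) (couplings μ.wt ν.wt) P

/-- A choice `(μ, ν, θ) ↦ π^θ(μ, ν)` of a matrix for all point clouds and all parameters. -/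
abbrev PlanFamily (X : Set (Fin d → ℝ)) (q : ℕ) : Type :=
  ∀ μ ν : PointCloud X, EuclideanSpace ℝ (Fin q) → Matrix (Fin μ.n) (Fin ν.n) ℝ

/-- `π` selects, for all `μ, ν` and every `θ`, a `θ`-generalized sliced Wasserstein plan, and does
so (Lebesgue-)measurably in `θ`, so that expectations of the plan make sense. -/
structure IsPlanSelection (p : ℝ) (φ : (Fin d → ℝ) → EuclideanSpace ℝ (Fin q) → ℝ)
    (π : PlanFamily X q) : Prop where
  isPlan : ∀ μ ν θ, IsPlan p φ μ ν θ (π μ ν θ)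
  aemeasurable : ∀ μ ν i j, AEMeasurable (fun θ => π μ ν θ i j) volume

/-- The value function `h(θ)(μ,ν) = ⟨C_{μν}, π^θ(μ,ν)⟩`. -/
def value (p : ℝ) (π : PlanFamily X q) (μ ν : PointCloud X) (θ : EuclideanSpace ℝ (Fin q)) : ℝ :=
  pairing (costMatrix p μ ν) (π μ ν θ)

/-- The standard Gaussian law `𝒩(0, Id_q)` of `Z`. -/
abbrev gaussian (q : ℕ) : Measure (EuclideanSpace ℝ (Fin q)) :=
  stdGaussian (EuclideanSpace ℝ (Fin q))

/-- The smoothed value function `h_ε(θ)(μ,ν) = E[h(θ + ε Z)(μ,ν)]`. -/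
def smoothValue (p : ℝ) (π : PlanFamily X q) (μ ν : PointCloud X) (ε : ℝ)
    (θ : EuclideanSpace ℝ (Fin q)) : ℝ :=
  ∫ z, value p π μ ν (θ + ε • z) ∂(gaussian q)

/-- The smoothed plan `π_ε^θ(μ,ν) = E[π^{θ + ε Z}(μ,ν)]` (entrywise expectation). -/
def smoothPlan (π : PlanFamily X q) (μ ν : PointCloud X) (ε : ℝ)
    (θ : EuclideanSpace ℝ (Fin q)) : Matrix (Fin μ.n) (Fin ν.n) ℝ :=
  Matrix.of fun i j => ∫ z, π μ ν (θ + ε • z) i j ∂(gaussian q)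

/-- `f` is continuously differentiable on an open set whose complement is null for the
`(q-1)`-dimensional Hausdorff measure. -/
def C1OffHausdorffNull (f : EuclideanSpace ℝ (Fin q) → ℝ) : Prop :=
  ∃ C : Set (EuclideanSpace ℝ (Fin q)),
    IsOpen C ∧ μH[(q : ℝ) - 1] Cᶜ = 0 ∧ ContDiffOn ℝ 1 f C

/-- `D`, given on point clouds, is a distance on `𝒫(X)`: it depends only on the measures that the
point clouds represent, and is the distance function of a metric on `𝒫(X)`. -/
def IsDistance (D : PointCloud X → PointCloud X → ℝ) : Prop :=
  ∃ M : MetricSpace (DiscreteMeasures X),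
    ∀ μ ν : PointCloud X, M.dist μ.toDiscrete ν.toDiscrete = D μ ν

end GSWP

end

/-! Two independent arguments meet here.

Smoothing. Costs of couplings are bounded, so `value p π μ ν` is a bounded, a.e. measurable function
`h` on the parameter space, and its Gaussian average is studied without further structure. Shifting
the Gaussian by `w` multiplies its density by `exp(⟨w,z⟩ - ‖w‖²/2)` (`integral_stdGaussian_add`), so
the dependence on `θ` moves from `h` to a smooth weight, which is differentiated under the integral.
Since `E[Z] = 0` and `E[⟨v,Z⟩Z] = v`, the gradient formula is `E[ε⁻¹(h(θ+εZ) - h(θ))Z]`, which tends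
to the gradient of `h` by dominated convergence.

Distance. For the strictly convex cost `|s-t|^p` on the line, every optimal plan has monotone
support, so its law is that of the pair of quantile functions on `(0,1]`, whichever minimizer was
selected (`sum_dirac_eq_map_quantile`). When `φ^θ` is injective on `X`, quantiles lift back to
points of `X`, and `h(θ)^{1/p}` becomes the `L^p` distance between two maps `(0,1] → ℓ^p`, each
determined by one measure alone (`ofReal_rpow_pairing_eq_eLpNorm`). The metric axioms follow from
this identity and the separation of points by the cost. The smoothed version is an `L^p(Gaussian)`
norm of such distances, so Minkowski applies once more. -/

noncomputable section

namespace GSWP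

/-! ### Density, translation and moments of the standard Gaussian. -/

section Gaussian

variable {E : Type*} [NormedAddCommGroup E] [InnerProductSpace ℝ E] [FiniteDimensional ℝ E]
  [MeasurableSpace E] [BorelSpace E]

/-- The density of the standard Gaussian measure with respect to Lebesgue measure. -/
def stdGaussianDensity (x : E) : ℝ :=
  (∫ y : E, Real.exp (-(1 / 2) * ‖y‖ ^ 2))⁻¹ * Real.exp (-(1 / 2) * ‖x‖ ^ 2)

lemma continuous_stdGaussianDensity : Continuous (stdGaussianDensity (E := E)) := by
  unfold stdGaussianDensity; fun_prop

lemma stdGaussianDensity_nonneg (x : E) : 0 ≤ stdGaussianDensity x := by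
  unfold stdGaussianDensity
  have : 0 ≤ ∫ y : E, Real.exp (-(1 / 2) * ‖y‖ ^ 2) := integral_nonneg fun _ => by positivity
  positivity

lemma integrable_stdGaussianDensity : Integrable (stdGaussianDensity (E := E)) := by
  refine Integrable.const_mul ?_ _
  have := (GaussianFourier.integrable_cexp_neg_mul_sq_norm_add (V := E) (b := 1 / 2)
    (by norm_num) 0 0).norm
  refine this.congr (Eventually.of_forall fun x => ?_)
  simp only [Complex.norm_exp]
  congr 1
  simp [← Complex.ofReal_pow]

/-- Both finite measures have characteristic function `exp(-‖t‖²/2)`. The Gaussian Fourier integral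
computes it for the density, and its value without the linear term identifies the normalizing
constant. -/
lemma stdGaussian_eq_withDensity :
    stdGaussian E = volume.withDensity fun x => ENNReal.ofReal (stdGaussianDensity x) := by
  have : IsFiniteMeasure
      ((volume : Measure E).withDensity fun x => ENNReal.ofReal (stdGaussianDensity x)) :=
    isFiniteMeasure_withDensity_ofReal integrable_stdGaussianDensity.2
  refine Measure.ext_of_charFun ?_
  ext t
  rw [charFun_stdGaussian, charFun_apply, integral_withDensity_eq_integral_toReal_smul
    (continuous_stdGaussianDensity.measurable.ennreal_ofReal) (by simp)]
  have h1 := GaussianFourier.integral_cexp_neg_mul_sq_norm_add (V := E) (b := 1 / 2)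
    (by norm_num) Complex.I t
  have h2 := GaussianFourier.integral_cexp_neg_mul_sq_norm (V := E) (b := 1 / 2) (by norm_num)
  have h3 : ((∫ y : E, Real.exp (-(1 / 2) * ‖y‖ ^ 2) : ℝ) : ℂ) =
      (Real.pi / (1 / 2) : ℂ) ^ (Module.finrank ℝ E / 2 : ℂ) := by
    rw [← h2, ← integral_complex_ofReal]
    simp
  have h4 : (Real.pi / (1 / 2) : ℂ) ^ (Module.finrank ℝ E / 2 : ℂ) ≠ 0 := by
    rw [Complex.cpow_def_of_ne_zero (by simp [Real.pi_ne_zero])]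
    exact Complex.exp_ne_zero _
  have h5 : ∀ x : E, (ENNReal.ofReal (stdGaussianDensity x)).toReal •
      Complex.exp (inner ℝ x t * Complex.I) =
      ((Real.pi / (1 / 2) : ℂ) ^ (Module.finrank ℝ E / 2 : ℂ))⁻¹ *
        Complex.exp (-(1 / 2) * ‖x‖ ^ 2 + Complex.I * inner ℝ t x) := fun x => by
    rw [ENNReal.toReal_ofReal (stdGaussianDensity_nonneg x), Complex.real_smul,
      stdGaussianDensity, Complex.ofReal_mul, Complex.ofReal_inv, h3, mul_assoc, Complex.exp_add,
      real_inner_comm, mul_comm Complex.I]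
    simp
  simp_rw [h5]
  rw [integral_const_mul, h1, ← mul_assoc, inv_mul_cancel₀ h4, one_mul]
  congr 1
  simp
  ring

lemma stdGaussian_absolutelyContinuous : stdGaussian E ≪ volume := by
  rw [stdGaussian_eq_withDensity]
  exact withDensity_absolutelyContinuous _ _

/-- This transfers Lebesgue-a.e. properties of the parameter, including measurability of the plan,
to Gaussian-a.e. properties of `z`. -/
lemma quasiMeasurePreserving_add_smul (θ : E) {ε : ℝ} (hε : ε ≠ 0) :
    Measure.QuasiMeasurePreserving (fun z : E => θ + ε • z) (stdGaussian E) volume := by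
  refine ⟨by fun_prop, ?_⟩
  refine (stdGaussian_absolutelyContinuous.map (by fun_prop)).trans ?_
  have h : (fun z : E => θ + ε • z) = (fun z => θ + z) ∘ fun z => ε • z := rfl
  rw [h, ← Measure.map_map (by fun_prop) (by fun_prop), Measure.map_addHaar_smul _ hε,
    Measure.map_smul, map_add_left_eq_self]
  exact Measure.smul_absolutelyContinuous

/-- Cameron–Martin formula. No integrability of `g` is needed: after a translation both sides are
the same Lebesgue integral. -/
lemma integral_stdGaussian_add {F : Type*} [NormedAddCommGroup F] [NormedSpace ℝ F]
    (g : E → F) (w : E) :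
    ∫ z, g (w + z) ∂(stdGaussian E) =
      ∫ z, Real.exp (inner ℝ w z - ‖w‖ ^ 2 / 2) • g z ∂(stdGaussian E) := by
  have hm := (continuous_stdGaussianDensity (E := E)).measurable.ennreal_ofReal
  rw [stdGaussian_eq_withDensity,
    integral_withDensity_eq_integral_toReal_smul hm (by simp),
    integral_withDensity_eq_integral_toReal_smul hm (by simp),
    ← integral_add_left_eq_self
      (fun z => (ENNReal.ofReal (stdGaussianDensity z)).toReal •
        Real.exp (inner ℝ w z - ‖w‖ ^ 2 / 2) • g z) w]
  congr 1 with z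
  rw [ENNReal.toReal_ofReal (stdGaussianDensity_nonneg _),
    ENNReal.toReal_ofReal (stdGaussianDensity_nonneg _), smul_smul]
  congr 1
  rw [stdGaussianDensity, stdGaussianDensity, mul_assoc, ← Real.exp_add]
  congr 2
  rw [norm_add_sq_real, inner_add_right, real_inner_self_eq_norm_sq]
  ring

lemma integrable_exp_mul_norm_stdGaussian (c : ℝ) :
    Integrable (fun z : E => Real.exp (c * ‖z‖)) (stdGaussian E) := by
  -- Fernique's theorem; completing the square then bounds `c‖z‖` by `c²/(4C) + C‖z‖²`.
  obtain ⟨C, hC, hint⟩ := IsGaussian.exists_integrable_exp_sq (stdGaussian E)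
  refine (hint.const_mul (Real.exp (c ^ 2 / (4 * C)))).mono' (by fun_prop)
    (Eventually.of_forall fun z => ?_)
  rw [Real.norm_eq_abs, Real.abs_exp, ← Real.exp_add, Real.exp_le_exp]
  have h : c ^ 2 / (4 * C) + C * ‖z‖ ^ 2 - c * ‖z‖ = C * (‖z‖ - c / (2 * C)) ^ 2 := by
    field_simp
    ring
  have := mul_nonneg hC.le (sq_nonneg (‖z‖ - c / (2 * C)))
  linarith

/-- The covariance of the standard Gaussian is the identity. -/
lemma integral_inner_smul_stdGaussian (v : E) :
    ∫ z, inner ℝ v z • z ∂(stdGaussian E) = v := by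
  have h2 : MemLp id 2 (stdGaussian E) := IsGaussian.memLp_two_id
  refine ext_inner_left ℝ fun u => ?_
  have hint : Integrable (fun z : E => inner ℝ v z • z) (stdGaussian E) := by
    refine Integrable.mono' ((h2.norm.integrable_sq).const_mul ‖v‖) (by fun_prop)
      (Eventually.of_forall fun z => ?_)
    rw [norm_smul]
    calc _ ≤ (‖v‖ * ‖z‖) * ‖z‖ := by gcongr; exact norm_inner_le_norm _ _
      _ = _ := by simp; ring
  have h := covarianceBilin_apply h2 u v
  rw [covarianceBilin_stdGaussian] at h
  have hz : (∫ x, id x ∂stdGaussian E) = 0 := integral_id_stdGaussian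
  rw [← integral_inner hint]
  simp_rw [inner_smul_right]
  simpa [hz, mul_comm, innerSL_apply_apply ℝ] using h.symm

/-! ### Gaussian smoothing of a bounded measurable function. -/

section Smoothing

variable {h : E → ℝ} {M : ℝ}

lemma aestronglyMeasurable_comp_add_smul (hm : AEMeasurable h) (θ : E) {ε : ℝ} (hε : ε ≠ 0) :
    AEStronglyMeasurable (fun z => h (θ + ε • z)) (stdGaussian E) :=
  hm.aestronglyMeasurable.comp_quasiMeasurePreserving (quasiMeasurePreserving_add_smul θ hε)

lemma integrable_comp_add_smul (hm : AEMeasurable h) (hM : ∀ x, |h x| ≤ M) (θ : E) {ε : ℝ}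
    (hε : ε ≠ 0) : Integrable (fun z => h (θ + ε • z)) (stdGaussian E) :=
  (integrable_const M).mono' (aestronglyMeasurable_comp_add_smul hm θ hε)
    (Eventually.of_forall fun _ => hM _)

lemma integrable_comp_add_smul_smul (hm : AEMeasurable h) (hM : ∀ x, |h x| ≤ M) (θ : E) {ε : ℝ}
    (hε : ε ≠ 0) : Integrable (fun z => h (θ + ε • z) • z) (stdGaussian E) := by
  refine Integrable.mono' ((IsGaussian.integrable_fun_id (μ := stdGaussian E)).norm.const_mul M)
    ((aestronglyMeasurable_comp_add_smul hm θ hε).smul (by fun_prop))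
    (Eventually.of_forall fun z => ?_)
  rw [norm_smul]
  gcongr
  exact hM _

/-- Gaussian smoothing of a bounded measurable function is differentiable, with Stein's formula
for the gradient. -/
lemma hasGradientAt_gaussian_smoothing (hm : AEMeasurable h) (hM : ∀ x, |h x| ≤ M) (θ : E) {ε : ℝ}
    (hε : ε ≠ 0) :
    HasGradientAt (fun θ' => ∫ z, h (θ' + ε • z) ∂(stdGaussian E))
      (ε⁻¹ • ∫ z, h (θ + ε • z) • z ∂(stdGaussian E)) θ := by
  set g : E → ℝ := fun z => h (θ + ε • z) with hg
  have hgm : AEStronglyMeasurable g (stdGaussian E) := aestronglyMeasurable_comp_add_smul hm θ hε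
  have hM0 : 0 ≤ M := (abs_nonneg _).trans (hM 0)
  -- The variable is `w = ε⁻¹(θ' - θ)`, differentiated at `w = 0`; only the Cameron–Martin weight
  -- depends on it.
  have key : HasFDerivAt
      (fun w : E => ∫ z, Real.exp (inner ℝ w z - ‖w‖ ^ 2 / 2) • g z ∂(stdGaussian E))
      (∫ z, (Real.exp (inner ℝ (0 : E) z - ‖(0 : E)‖ ^ 2 / 2) * g z) •
        (innerSL ℝ z - innerSL ℝ (0 : E)) ∂(stdGaussian E)) 0 := by
    -- On the unit ball the weight is at most `exp(‖z‖ - ‖w‖²/2)`, and `‖z - w‖ ≤ exp ‖z‖ *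
    -- exp(‖w‖²/2)`; the terms in `‖w‖²` cancel, which leaves `exp(2‖z‖)`.
    refine hasFDerivAt_integral_of_dominated_of_fderiv_le
      (bound := fun z => M * Real.exp (2 * ‖z‖))
      (F' := fun w z => (Real.exp (inner ℝ w z - ‖w‖ ^ 2 / 2) * g z) •
        (innerSL ℝ z - innerSL ℝ w)) (Metric.ball_mem_nhds (0 : E) one_pos) ?_ ?_ ?_ ?_ ?_ ?_
    · refine Eventually.of_forall fun w => ?_
      have hc : Continuous fun z : E => Real.exp (inner ℝ w z - ‖w‖ ^ 2 / 2) := by fun_prop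
      exact hc.aestronglyMeasurable.smul hgm
    · simpa using integrable_comp_add_smul hm hM θ hε
    · refine AEStronglyMeasurable.smul (AEStronglyMeasurable.mul ?_ hgm) ?_
      · exact Continuous.aestronglyMeasurable (by fun_prop)
      · exact Continuous.aestronglyMeasurable (by fun_prop)
    · refine Eventually.of_forall fun z w hw => ?_
      have hw1 : ‖w‖ ≤ 1 := by simpa using (mem_ball_zero_iff.1 hw).le
      rw [norm_smul, norm_mul, Real.norm_eq_abs, Real.abs_exp, ← map_sub, innerSL_apply_norm,
        mul_comm (Real.exp _), mul_assoc]
      have h1 : Real.exp (inner ℝ w z - ‖w‖ ^ 2 / 2) ≤ Real.exp (‖z‖ - ‖w‖ ^ 2 / 2) := by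
        gcongr
        exact (real_inner_le_norm w z).trans (mul_le_of_le_one_left (norm_nonneg _) hw1)
      have h2 : ‖z - w‖ ≤ Real.exp ‖z‖ * Real.exp (‖w‖ ^ 2 / 2) := by
        rw [← Real.exp_add]
        have h5 := norm_sub_le z w
        have h6 : (1 + ‖z‖) * (1 + ‖w‖ ^ 2 / 2) ≤ Real.exp ‖z‖ * Real.exp (‖w‖ ^ 2 / 2) := by
          gcongr
          · have := Real.add_one_le_exp ‖z‖; linarith
          · have := Real.add_one_le_exp (‖w‖ ^ 2 / 2); linarith
        rw [← Real.exp_add] at h6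
        nlinarith [norm_nonneg z, norm_nonneg w]
      calc _ ≤ M * (Real.exp (‖z‖ - ‖w‖ ^ 2 / 2) * (Real.exp ‖z‖ * Real.exp (‖w‖ ^ 2 / 2))) := by
            gcongr
            exact hM _
        _ = _ := by
            rw [← Real.exp_add, ← Real.exp_add]
            ring_nf
    · exact (integrable_exp_mul_norm_stdGaussian 2).const_mul M
    · refine Eventually.of_forall fun z w _ => ?_
      have h1 : HasFDerivAt (fun w : E => inner ℝ w z - ‖w‖ ^ 2 / 2)
          (innerSL ℝ z - innerSL ℝ w) w := by
        have ha : HasFDerivAt (fun w : E => inner ℝ w z) (innerSL ℝ z) w := by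
          simpa [real_inner_comm] using (innerSL ℝ z).hasFDerivAt (x := w)
        have hb := ((hasStrictFDerivAt_norm_sq w).hasFDerivAt).const_mul (1 / 2 : ℝ)
        refine (ha.sub hb).congr_fderiv ?_ |>.congr_of_eventuallyEq ?_
        · ext y; simp
        · exact Eventually.of_forall fun y => by simp; ring
      refine (h1.exp.mul_const (g z)).congr_fderiv ?_
      rw [smul_smul, mul_comm]
  have hlin : HasFDerivAt (fun θ' : E => ε⁻¹ • (θ' - θ)) (ε⁻¹ • ContinuousLinearMap.id ℝ E) θ :=
    ((hasFDerivAt_id θ).sub_const θ).const_smul ε⁻¹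
  have hcomp := HasFDerivAt.comp θ (g := fun w : E =>
    ∫ z, Real.exp (inner ℝ w z - ‖w‖ ^ 2 / 2) • g z ∂(stdGaussian E))
    (f := fun θ' : E => ε⁻¹ • (θ' - θ)) (by simpa using key) hlin
  rw [hasGradientAt_iff_hasFDerivAt]
  refine (hcomp.congr_fderiv ?_).congr_of_eventuallyEq (Eventually.of_forall fun θ' => ?_)
  · ext y
    have hi := integrable_comp_add_smul_smul hm hM θ hε
    have hi' : ∫ z, h (θ + ε • z) • innerSL ℝ z ∂(stdGaussian E) =
        innerSL ℝ (∫ z, h (θ + ε • z) • z ∂(stdGaussian E)) := by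
      rw [← (innerSL ℝ (E := E)).integral_comp_comm hi]
      simp
    simp [hg, hi', innerSL_apply_apply ℝ]
  · simp only [Function.comp_apply]
    rw [← integral_stdGaussian_add g (ε⁻¹ • (θ' - θ))]
    congr 1 with z
    simp only [hg, smul_add, smul_smul, mul_inv_cancel₀ hε, one_smul]
    congr 1
    abel

lemma tendsto_gaussian_smoothing (hm : AEMeasurable h) (hM : ∀ x, |h x| ≤ M) {θ : E}
    (hc : ContinuousAt h θ) :
    Tendsto (fun ε : ℝ => ∫ z, h (θ + ε • z) ∂(stdGaussian E)) (𝓝[>] 0) (𝓝 (h θ)) := by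
  have h0 : h θ = ∫ _, h θ ∂(stdGaussian E) := by simp
  rw [h0]
  refine tendsto_integral_filter_of_dominated_convergence (fun _ => M) ?_ ?_ (integrable_const M)
    (Eventually.of_forall fun z => ?_)
  · filter_upwards [self_mem_nhdsWithin] with ε hε
    exact aestronglyMeasurable_comp_add_smul hm θ (ne_of_gt hε)
  · exact Eventually.of_forall fun ε => Eventually.of_forall fun z => hM _
  · have ht : Tendsto (fun ε : ℝ => θ + ε • z) (𝓝[>] 0) (𝓝 θ) := by
      have : Continuous fun ε : ℝ => θ + ε • z := by fun_prop
      simpa using (this.tendsto 0).mono_left nhdsWithin_le_nhds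
    exact hc.tendsto.comp ht

-- Differentiability gives a linear bound near `θ`; at distance at least `δ`, the bound `2M ≤
-- (2M/δ)‖v‖` takes over. The global bound makes the difference quotients dominated uniformly in
-- `ε`.
omit [FiniteDimensional ℝ E] [MeasurableSpace E] [BorelSpace E] in
lemma exists_norm_sub_le_of_differentiableAt (hM : ∀ x, |h x| ≤ M) {θ : E}
    (hd : DifferentiableAt ℝ h θ) : ∃ K, ∀ v, |h (θ + v) - h θ| ≤ K * ‖v‖ := by
  obtain ⟨K, hK⟩ := hd.hasFDerivAt.isBigO_sub.bound
  obtain ⟨δ, hδ, hball⟩ := Metric.eventually_nhds_iff_ball.1 hK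
  have hM0 : 0 ≤ M := (abs_nonneg _).trans (hM 0)
  refine ⟨max K (2 * M / δ), fun v => ?_⟩
  by_cases hv : ‖v‖ < δ
  · have := hball (θ + v) (by simpa using hv)
    simp only [add_sub_cancel_left, Real.norm_eq_abs] at this
    exact this.trans (by gcongr; exact le_max_left _ _)
  · push Not at hv
    calc |h (θ + v) - h θ| ≤ |h (θ + v)| + |h θ| := abs_sub _ _
      _ ≤ 2 * M := by linarith [hM (θ + v), hM θ]
      _ = 2 * M / δ * δ := by field_simp
      _ ≤ max K (2 * M / δ) * ‖v‖ := by gcongr; exact le_max_right _ _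

/-- The gradients of the Gaussian smoothings of a bounded measurable function converge to its
gradient at every point of differentiability. -/
lemma tendsto_gradient_gaussian_smoothing (hm : AEMeasurable h) (hM : ∀ x, |h x| ≤ M) {θ : E}
    (hd : DifferentiableAt ℝ h θ) :
    Tendsto (fun ε : ℝ => gradient (fun θ' => ∫ z, h (θ' + ε • z) ∂(stdGaussian E)) θ) (𝓝[>] 0)
      (𝓝 (gradient h θ)) := by
  obtain ⟨K, hK⟩ := exists_norm_sub_le_of_differentiableAt hM hd
  have hlim : Tendsto (fun ε : ℝ => ∫ z, (ε⁻¹ * (h (θ + ε • z) - h θ)) • z ∂(stdGaussian E))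
      (𝓝[>] 0) (𝓝 (gradient h θ)) := by
    conv => enter [3, 1]; rw [← integral_inner_smul_stdGaussian (gradient h θ)]
    refine tendsto_integral_filter_of_dominated_convergence (fun z => K * ‖z‖ ^ 2) ?_ ?_ ?_
      (Eventually.of_forall fun z => ?_)
    · filter_upwards [self_mem_nhdsWithin] with ε hε
      refine AEStronglyMeasurable.smul (AEStronglyMeasurable.const_mul ?_ _) (by fun_prop)
      exact (aestronglyMeasurable_comp_add_smul hm θ (ne_of_gt hε)).sub aestronglyMeasurable_const
    · filter_upwards [self_mem_nhdsWithin] with ε (hε : 0 < ε)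
      refine Eventually.of_forall fun z => ?_
      rw [norm_smul, norm_mul, norm_inv, Real.norm_of_nonneg hε.le]
      calc ε⁻¹ * ‖h (θ + ε • z) - h θ‖ * ‖z‖ ≤ ε⁻¹ * (K * ‖ε • z‖) * ‖z‖ := by
            gcongr; exact hK _
        _ = K * ‖z‖ ^ 2 := by
            rw [norm_smul, Real.norm_of_nonneg hε.le]; field_simp
    · exact ((IsGaussian.memLp_two_id (μ := stdGaussian E)).norm.integrable_sq).const_mul K
    · refine Tendsto.smul_const ?_ z
      have := hd.hasFDerivAt.hasLineDerivAt z
      have h2 := (this.tendsto_slope_zero_right)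
      have h3 : (fderiv ℝ h θ) z = inner ℝ (gradient h θ) z := by
        rw [← InnerProductSpace.toDual_apply_apply, gradient, LinearIsometryEquiv.apply_symm_apply]
      rw [← h3]
      simpa using h2
  refine hlim.congr' ?_
  filter_upwards [self_mem_nhdsWithin] with ε (hε : 0 < ε)
  rw [(hasGradientAt_gaussian_smoothing hm hM θ hε.ne').gradient]
  -- Subtracting `h θ • z` changes nothing in the integral, because the Gaussian is centred.
  have h1 : ∀ z : E, (ε⁻¹ * (h (θ + ε • z) - h θ)) • z =
      ε⁻¹ • (h (θ + ε • z) • z - h θ • z) := fun z => by rw [mul_smul, sub_smul]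
  simp_rw [h1]
  have hint : Integrable (fun z : E => h θ • z) (stdGaussian E) :=
    Integrable.smul (h θ) IsGaussian.integrable_fun_id
  have hid : (∫ z : E, z ∂stdGaussian E) = 0 := integral_id_stdGaussian
  rw [integral_smul, integral_sub (integrable_comp_add_smul_smul hm hM θ hε.ne')
    hint, integral_smul, hid, smul_zero, sub_zero]

end Smoothing

end Gaussian

/-- Hausdorff measure decreases as the dimension grows, and in dimension `q` a null set is Lebesgue
null. -/
lemma volume_eq_zero_of_hausdorffMeasure_eq_zero {q : ℕ} {s : Set (EuclideanSpace ℝ (Fin q))}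
    (hs : μH[(q : ℝ) - 1] s = 0) : volume s = 0 := by
  have h : μH[(q : ℝ)] s = 0 :=
    le_antisymm ((Measure.hausdorffMeasure_mono (by linarith) s).trans hs.le) (by simp)
  exact Measure.absolutelyContinuous_isAddHaarMeasure _ _ h

/-! ### Monotonicity of optimal plans on the line. -/

section Transport

/-- If `|x| ≠ |y|`, strict convexity of `t ↦ t^p` on the half-line suffices. If `y = -x`, strictness
comes from cancellation in the convex combination. -/
lemma strictConvexOn_abs_rpow {p : ℝ} (hp : 1 < p) :
    StrictConvexOn ℝ Set.univ fun x : ℝ => |x| ^ p := by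
  refine ⟨convex_univ, fun x _ y _ hxy a b ha hb hab => ?_⟩
  have hp0 : 0 < p := by linarith
  have htri : |a • x + b • y| ≤ a * |x| + b * |y| := by
    refine (abs_add_le _ _).trans (le_of_eq ?_)
    simp [abs_mul, abs_of_pos ha, abs_of_pos hb]
  by_cases h : |x| = |y|
  · have hy : y = -x := by
      rcases abs_eq_abs.1 h with h | h
      · exact absurd h hxy
      · linarith
    have hx : x ≠ 0 := by rintro rfl; simp [hy] at hxy
    have hlt : |a • x + b • y| < |x| := by
      have : a • x + b • y = (a - b) * x := by simp [hy]; ring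
      rw [this, abs_mul]
      refine mul_lt_of_lt_one_left (abs_pos.2 hx) ?_
      rw [abs_lt]; constructor <;> linarith
    calc |a • x + b • y| ^ p < |x| ^ p := Real.rpow_lt_rpow (abs_nonneg _) hlt hp0
      _ = a • |x| ^ p + b • |y| ^ p := by
          rw [← h, ← add_smul, hab, one_smul]
  · calc |a • x + b • y| ^ p ≤ (a * |x| + b * |y|) ^ p :=
          Real.rpow_le_rpow (abs_nonneg _) htri hp0.le
      _ < a • |x| ^ p + b • |y| ^ p :=
          (strictConvexOn_rpow hp).2 (abs_nonneg x) (abs_nonneg y) h ha hb hab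

/-- A strictly convex function satisfies the strict Monge condition. -/
lemma abs_rpow_swap_lt {p : ℝ} (hp : 1 < p) {s s' t t' : ℝ} (hs : s < s') (ht : t' < t) :
    |s - t'| ^ p + |s' - t| ^ p < |s - t| ^ p + |s' - t'| ^ p := by
  have hα : 0 < s' - s := sub_pos.2 hs
  have hβ : 0 < t - t' := sub_pos.2 ht
  have hne : s - t ≠ s' - t' := by intro h; linarith
  -- The differences `s - t'` and `s' - t` are convex combinations of `s - t` and `s' - t'` with the
  -- two weights interchanged, so adding the two strict convexity inequalities restores total weight
  -- one.
  set c := (s' - s) + (t - t') with hc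
  have hc0 : 0 < c := by positivity
  have hsum : (s' - s) / c + (t - t') / c = 1 := by rw [← add_div, ← hc, div_self hc0.ne']
  have hsum' : (t - t') / c + (s' - s) / c = 1 := by rw [add_comm, hsum]
  have h1 := (strictConvexOn_abs_rpow hp).2 (Set.mem_univ (s - t)) (Set.mem_univ (s' - t')) hne
    (div_pos hα hc0) (div_pos hβ hc0) hsum
  have h2 := (strictConvexOn_abs_rpow hp).2 (Set.mem_univ (s - t)) (Set.mem_univ (s' - t')) hne
    (div_pos hβ hc0) (div_pos hα hc0) hsum'
  have e1 : ((s' - s) / c) • (s - t) + ((t - t') / c) • (s' - t') = s - t' := by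
    simp only [smul_eq_mul]; field_simp; rw [hc]; ring
  have e2 : ((t - t') / c) • (s - t) + ((s' - s) / c) • (s' - t') = s' - t := by
    simp only [smul_eq_mul]; field_simp; rw [hc]; ring
  simp only [e1] at h1
  simp only [e2] at h2
  calc _ < _ := add_lt_add h1 h2
    _ = ((s' - s) / c + (t - t') / c) * |s - t| ^ p +
        ((t - t') / c + (s' - s) / c) * |s' - t'| ^ p := by simp only [smul_eq_mul]; ring
    _ = _ := by rw [hsum, hsum', one_mul, one_mul]

variable {n m : ℕ} {a : Fin n → ℝ} {b : Fin m → ℝ} {P : Matrix (Fin n) (Fin m) ℝ}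
  {s : Fin n → ℝ} {t : Fin m → ℝ}

/-- An optimal plan for the cost `|s_i - t_j|^p`, `p > 1`, has monotone support. -/
lemma monotone_support_of_isMinOn {p : ℝ} (hp : 1 < p) (hP : P ∈ couplings a b)
    (hmin : IsMinOn (fun P' => pairing (Matrix.of fun i j => |s i - t j| ^ p) P')
      (couplings a b) P) {i k : Fin n} {j l : Fin m} (hij : 0 < P i j) (hkl : 0 < P k l)
    (hik : s i < s k) : t j ≤ t l := by
  by_contra! hlj
  have hik' : i ≠ k := by rintro rfl; exact lt_irrefl _ hik
  have hjl' : j ≠ l := by rintro rfl; exact lt_irrefl _ hlj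
  set δ := min (P i j) (P k l) with hδ
  have hδ0 : 0 < δ := lt_min hij hkl
  -- The rank-one perturbation `δ u vᵀ` moves mass `δ` from the entries `(i,j)`, `(k,l)` to `(i,l)`,
  -- `(k,j)`. As `u` and `v` sum to zero, the marginals are kept.
  set u : Fin n → ℝ := Pi.single i 1 - Pi.single k 1 with hu
  set v : Fin m → ℝ := Pi.single l 1 - Pi.single j 1 with hv
  have hu0 : ∑ i', u i' = 0 := by simp [hu]
  have hv0 : ∑ j', v j' = 0 := by simp [hv]
  set P' : Matrix (Fin n) (Fin m) ℝ := Matrix.of fun i' j' => P i' j' + δ * (u i' * v j') with hP'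
  have hmem : P' ∈ couplings a b := by
    refine ⟨fun i' j' => ?_, fun i' => ?_, fun j' => ?_⟩
    · have h0 := hP.1 i' j'
      have h1 : δ ≤ P i j := min_le_left _ _
      have h2 : δ ≤ P k l := min_le_right _ _
      simp only [hP', hu, hv, Matrix.of_apply, Pi.sub_apply, Pi.single_apply]
      by_cases e1 : i' = i <;> by_cases e2 : i' = k <;> by_cases e3 : j' = l <;>
        by_cases e4 : j' = j <;> subst_vars <;> simp_all only [if_true, if_false] <;>
        linarith
    · simp [hP', Finset.sum_add_distrib, ← Finset.mul_sum, hv0, hP.2.1 i']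
    · simp [hP', Finset.sum_add_distrib, ← Finset.mul_sum, ← Finset.sum_mul, hu0, hP.2.2 j']
  have hle := hmin hmem
  set c : Fin n → Fin m → ℝ := fun i j => |s i - t j| ^ p with hc
  have hval : pairing (Matrix.of c) P' =
      pairing (Matrix.of c) P + δ * (c i l - c i j - (c k l - c k j)) := by
    have hinner : ∀ i', ∑ j', c i' j' * v j' = c i' l - c i' j := fun i' => by
      simp [hv, mul_sub, Finset.sum_sub_distrib, Pi.single_apply]
    have houter : ∑ i', u i' * (c i' l - c i' j) = c i l - c i j - (c k l - c k j) := by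
      simp [hu, sub_mul, Finset.sum_sub_distrib, Pi.single_apply]
    rw [← houter, Finset.mul_sum]
    simp only [pairing, ← Finset.sum_add_distrib]
    refine Finset.sum_congr rfl fun i' _ => ?_
    rw [← hinner i', Finset.mul_sum, Finset.mul_sum, ← Finset.sum_add_distrib]
    refine Finset.sum_congr rfl fun j' _ => ?_
    simp only [hP', Matrix.of_apply]
    ring
  have hle' : pairing (Matrix.of c) P ≤ pairing (Matrix.of c) P' := hle
  rw [hval] at hle'
  have hlt : c i l + c k j < c i j + c k l := abs_rpow_swap_lt hp hik hlj
  have : δ * (c i l - c i j - (c k l - c k j)) < 0 := mul_neg_of_pos_of_neg hδ0 (by linarith)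
  linarith

/-- The distribution function of the weighted points `∑ a_i δ_{s_i}` on the line. -/
def weightCdf (a s : Fin n → ℝ) (x : ℝ) : ℝ := ∑ i, if s i ≤ x then a i else 0

/-- The joint distribution function of a coupling with monotone support. -/
lemma sum_coupling_eq_min (hP : P ∈ couplings a b)
    (hmono : ∀ i k j l, 0 < P i j → 0 < P k l → s i < s k → t j ≤ t l) (x y : ℝ) :
    ∑ i, ∑ j, (if s i ≤ x ∧ t j ≤ y then P i j else 0) =
      min (weightCdf a s x) (weightCdf b t y) := by
  have ha : weightCdf a s x = ∑ i, ∑ j, if s i ≤ x then P i j else 0 := by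
    refine Finset.sum_congr rfl fun i _ => ?_
    split_ifs
    · exact (hP.2.1 i).symm
    · simp
  have hb : weightCdf b t y = ∑ i, ∑ j, if t j ≤ y then P i j else 0 := by
    rw [Finset.sum_comm]
    refine Finset.sum_congr rfl fun j _ => ?_
    split_ifs
    · exact (hP.2.2 j).symm
    · simp
  have hla : ∑ i, ∑ j, (if s i ≤ x ∧ t j ≤ y then P i j else 0) ≤ weightCdf a s x := by
    rw [ha]
    refine Finset.sum_le_sum fun i _ => Finset.sum_le_sum fun j _ => ?_
    have := hP.1 i j
    split_ifs <;> grind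
  have hlb : ∑ i, ∑ j, (if s i ≤ x ∧ t j ≤ y then P i j else 0) ≤ weightCdf b t y := by
    rw [hb]
    refine Finset.sum_le_sum fun i _ => Finset.sum_le_sum fun j _ => ?_
    have := hP.1 i j
    split_ifs <;> grind
  refine le_antisymm (le_min hla hlb) ?_
  -- Monotone support forbids mass in both `{s ≤ x, t > y}` and `{s > x, t ≤ y}`. Whichever is empty
  -- of mass, the joint distribution function equals one of the marginal ones.
  by_cases h : ∀ i j, s i ≤ x → y < t j → P i j = 0
  · refine (min_le_left _ _).trans (le_of_eq ?_)
    rw [ha]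
    refine Finset.sum_congr rfl fun i _ => Finset.sum_congr rfl fun j _ => ?_
    have := h i j
    split_ifs <;> grind
  · push Not at h
    obtain ⟨i₀, j₀, hi₀, hj₀, h0⟩ := h
    have hpos : 0 < P i₀ j₀ := lt_of_le_of_ne (hP.1 _ _) (Ne.symm h0)
    refine (min_le_right _ _).trans (le_of_eq ?_)
    rw [hb]
    refine Finset.sum_congr rfl fun i _ => Finset.sum_congr rfl fun j _ => ?_
    have h1 : x < s i → t j ≤ y → P i j = 0 := fun hi hj => by
      by_contra hne
      have := hmono i₀ i j₀ j hpos (lt_of_le_of_ne (hP.1 _ _) (Ne.symm hne)) (by linarith)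
      linarith
    split_ifs <;> grind

/-! ### Quantile functions and the monotone coupling. -/

/-- The quantile function of the weighted points `∑ a_i δ_{s_i}` on the line. -/
def quantile (a s : Fin n → ℝ) (u : ℝ) : ℝ := sInf {x | u ≤ weightCdf a s x}

lemma monotone_weightCdf (ha : ∀ i, 0 ≤ a i) : Monotone (weightCdf a s) := fun x y hxy => by
  refine Finset.sum_le_sum fun i _ => ?_
  have := ha i
  split_ifs <;> grind

lemma weightCdf_le_one (ha : ∀ i, 0 ≤ a i) (hsum : ∑ i, a i = 1) (x : ℝ) :
    weightCdf a s x ≤ 1 := by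
  rw [← hsum]
  refine Finset.sum_le_sum fun i _ => ?_
  have := ha i
  split_ifs <;> grind

lemma weightCdf_nonneg (ha : ∀ i, 0 ≤ a i) (x : ℝ) : 0 ≤ weightCdf a s x :=
  Finset.sum_nonneg fun i _ => by split_ifs <;> simp [ha]

/-- The distribution function is a step function that can jump only at the `s i`, so its superlevel
sets are closed half-lines starting at one of them. -/
lemma exists_quantile_eq (ha : ∀ i, 0 ≤ a i) (hsum : ∑ i, a i = 1) {u : ℝ} (hu : 0 < u)
    (hu1 : u ≤ 1) : ∃ i, quantile a s u = s i ∧ {x | u ≤ weightCdf a s x} = Set.Ici (s i) := by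
  classical
  suffices h : ∃ i, {x | u ≤ weightCdf a s x} = Set.Ici (s i) by
    obtain ⟨i, hi⟩ := h
    exact ⟨i, by rw [quantile, hi, csInf_Ici], hi⟩
  have hne : (Finset.univ : Finset (Fin n)).Nonempty := by
    by_contra h
    rw [Finset.not_nonempty_iff_eq_empty] at h
    simp [h] at hsum
  obtain ⟨i₁, -, hi₁⟩ := Finset.exists_max_image Finset.univ s hne
  have htop : weightCdf a s (s i₁) = 1 := by
    rw [← hsum]
    exact Finset.sum_congr rfl fun i _ => if_pos (hi₁ i (Finset.mem_univ i))
  obtain ⟨i, hi, himin⟩ := Finset.exists_min_image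
    (Finset.univ.filter fun i => u ≤ weightCdf a s (s i)) s ⟨i₁, by simp [htop, hu1]⟩
  simp only [Finset.mem_filter, Finset.mem_univ, true_and] at hi himin
  refine ⟨i, Set.Subset.antisymm (fun x hx => ?_) fun x hx => ?_⟩
  -- Since `u > 0`, some `s j` lies below `x`; the largest such one already has the same value of
  -- the distribution function.
  · have hne' : (Finset.univ.filter fun j => s j ≤ x).Nonempty := by
      by_contra h
      rw [Finset.not_nonempty_iff_eq_empty, Finset.filter_eq_empty_iff] at h
      have : weightCdf a s x = 0 :=
        Finset.sum_eq_zero fun j hj => if_neg (h hj)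
      simp only [Set.mem_ofPred_eq, this] at hx
      linarith
    obtain ⟨j, hj, hjmax⟩ := Finset.exists_max_image _ s hne'
    simp only [Finset.mem_filter, Finset.mem_univ, true_and] at hj hjmax
    have heq : weightCdf a s (s j) = weightCdf a s x := by
      refine Finset.sum_congr rfl fun k _ => ?_
      have := hjmax k
      split_ifs <;> grind
    exact (himin j (heq ▸ hx)).trans hj
  · exact hi.trans (monotone_weightCdf ha hx)

/-- The Galois connection fails at `u = 0`, where the superlevel set is all of `ℝ` and `sInf`
returns `0`; hence the half-open interval `(0,1]`. -/
lemma quantile_le_iff (ha : ∀ i, 0 ≤ a i) (hsum : ∑ i, a i = 1) {u : ℝ} (hu : 0 < u)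
    (hu1 : u ≤ 1) (x : ℝ) : quantile a s u ≤ x ↔ u ≤ weightCdf a s x := by
  obtain ⟨i, hi, h⟩ := exists_quantile_eq (s := s) ha hsum hu hu1
  rw [hi]
  exact (Set.ext_iff.1 h x).symm

lemma measurable_quantile (ha : ∀ i, 0 ≤ a i) (hsum : ∑ i, a i = 1) :
    Measurable fun u : Set.Ioc (0 : ℝ) 1 => quantile a s u := by
  refine measurable_of_Iic fun x => ?_
  have : (fun u : Set.Ioc (0 : ℝ) 1 => quantile a s u) ⁻¹' Set.Iic x =
      {u : Set.Ioc (0 : ℝ) 1 | (u : ℝ) ≤ weightCdf a s x} := by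
    ext u
    exact quantile_le_iff ha hsum u.2.1 u.2.2 x
  rw [this]
  exact measurableSet_le measurable_subtype_coe measurable_const

/-- Lebesgue measure on `(0, 1]`. -/
def unitMeasure : Measure (Set.Ioc (0 : ℝ) 1) := volume.comap Subtype.val

lemma unitMeasure_le {c : ℝ} (hc : c ≤ 1) :
    unitMeasure {u : Set.Ioc (0 : ℝ) 1 | (u : ℝ) ≤ c} = ENNReal.ofReal c := by
  have h : Subtype.val '' {u : Set.Ioc (0 : ℝ) 1 | (u : ℝ) ≤ c} = Set.Ioc 0 c := by
    ext x
    simp only [Set.mem_image, Set.mem_ofPred_eq, Subtype.exists, Set.mem_Ioc]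
    constructor
    · rintro ⟨y, hy, hyc, rfl⟩
      exact ⟨hy.1, hyc⟩
    · rintro ⟨h0, h1⟩
      exact ⟨x, ⟨h0, h1.trans hc⟩, h1, rfl⟩
  rw [unitMeasure, comap_subtype_coe_apply measurableSet_Ioc, h, Real.volume_Ioc, sub_zero]

instance : IsFiniteMeasure unitMeasure := by
  refine ⟨?_⟩
  have h : {u : Set.Ioc (0 : ℝ) 1 | (u : ℝ) ≤ 1} = Set.univ := by
    ext u; simp [u.2.2]
  rw [← h, unitMeasure_le le_rfl]
  simp

/-- The one-dimensional uniqueness theorem is applied to one coordinate at a time, with the other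
confined to a fixed set. -/
lemma ext_of_Iic_prod_Iic {μ ν : Measure (ℝ × ℝ)} [IsFiniteMeasure μ] [IsFiniteMeasure ν]
    (h : ∀ x y, μ (Set.Iic x ×ˢ Set.Iic y) = ν (Set.Iic x ×ˢ Set.Iic y)) : μ = ν := by
  have h1 : ∀ x (T : Set ℝ), MeasurableSet T → μ (Set.Iic x ×ˢ T) = ν (Set.Iic x ×ˢ T) := by
    intro x T hT
    have key : (μ.restrict (Set.Iic x ×ˢ Set.univ)).map Prod.snd =
        (ν.restrict (Set.Iic x ×ˢ Set.univ)).map Prod.snd := by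
      refine Measure.ext_of_Iic _ _ fun y => ?_
      rw [Measure.map_apply measurable_snd measurableSet_Iic,
        Measure.map_apply measurable_snd measurableSet_Iic,
        Measure.restrict_apply (measurable_snd measurableSet_Iic),
        Measure.restrict_apply (measurable_snd measurableSet_Iic)]
      convert h x y using 2 <;> (ext ⟨_, _⟩; simp [and_comm])
    have := congrArg (fun ρ => ρ T) key
    rw [Measure.map_apply measurable_snd hT, Measure.map_apply measurable_snd hT,
      Measure.restrict_apply (measurable_snd hT), Measure.restrict_apply (measurable_snd hT)]
      at this
    convert this using 2 <;> (ext ⟨_, _⟩; simp [and_comm])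
  refine Measure.ext_prod fun {S T} hS hT => ?_
  have key : (μ.restrict (Set.univ ×ˢ T)).map Prod.fst =
      (ν.restrict (Set.univ ×ˢ T)).map Prod.fst := by
    refine Measure.ext_of_Iic _ _ fun x => ?_
    rw [Measure.map_apply measurable_fst measurableSet_Iic,
      Measure.map_apply measurable_fst measurableSet_Iic,
      Measure.restrict_apply (measurable_fst measurableSet_Iic),
      Measure.restrict_apply (measurable_fst measurableSet_Iic)]
    convert h1 x T hT using 2 <;> (ext ⟨_, _⟩; simp)
  have := congrArg (fun ρ => ρ S) key
  rw [Measure.map_apply measurable_fst hS, Measure.map_apply measurable_fst hS,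
    Measure.restrict_apply (measurable_fst hS), Measure.restrict_apply (measurable_fst hS)] at this
  convert this using 2 <;> (ext ⟨_, _⟩; simp)

/-- The law of a coupling with monotone support is the law of the pair of quantile functions. -/
lemma sum_dirac_eq_map_quantile (ha : ∀ i, 0 ≤ a i) (hsa : ∑ i, a i = 1) (hb : ∀ j, 0 ≤ b j)
    (hsb : ∑ j, b j = 1) (hP : P ∈ couplings a b)
    (hmono : ∀ i k j l, 0 < P i j → 0 < P k l → s i < s k → t j ≤ t l) :
    ∑ i, ∑ j, ENNReal.ofReal (P i j) • Measure.dirac (s i, t j) =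
      unitMeasure.map fun u : Set.Ioc (0 : ℝ) 1 => (quantile a s u, quantile b t u) := by
  have hmeas : Measurable fun u : Set.Ioc (0 : ℝ) 1 => (quantile a s u, quantile b t u) :=
    (measurable_quantile ha hsa).prodMk (measurable_quantile hb hsb)
  have hfin : IsFiniteMeasure (∑ i, ∑ j, ENNReal.ofReal (P i j) • Measure.dirac (s i, t j)) := by
    refine ⟨?_⟩
    simp [Measure.finsetSum_apply]
  refine ext_of_Iic_prod_Iic fun x y => ?_
  rw [Measure.map_apply hmeas (measurableSet_Iic.prod measurableSet_Iic)]
  -- By the Galois connection, a quadrant pulls back to an initial interval whose length is the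
  -- minimum found in `sum_coupling_eq_min`.
  have h1 : (fun u : Set.Ioc (0 : ℝ) 1 => (quantile a s u, quantile b t u)) ⁻¹'
      (Set.Iic x ×ˢ Set.Iic y) =
      {u : Set.Ioc (0 : ℝ) 1 | (u : ℝ) ≤ min (weightCdf a s x) (weightCdf b t y)} := by
    ext u
    simp only [Set.mem_preimage, Set.mem_prod, Set.mem_Iic, Set.mem_ofPred_eq, le_min_iff,
      quantile_le_iff ha hsa u.2.1 u.2.2, quantile_le_iff hb hsb u.2.1 u.2.2]
  rw [h1, unitMeasure_le ((min_le_left _ _).trans (weightCdf_le_one ha hsa x)),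
    ← sum_coupling_eq_min hP hmono, ENNReal.ofReal_sum_of_nonneg]
  · simp only [Measure.finsetSum_apply, Measure.smul_apply, smul_eq_mul]
    refine Finset.sum_congr rfl fun i _ => ?_
    rw [ENNReal.ofReal_sum_of_nonneg]
    · refine Finset.sum_congr rfl fun j _ => ?_
      by_cases h : s i ≤ x ∧ t j ≤ y
      · simp [h, Set.indicator]
      · simp [h, Set.indicator]
    · intro j _
      split_ifs <;> simp [hP.1]
  · intro i _
    refine Finset.sum_nonneg fun j _ => ?_
    split_ifs <;> simp [hP.1]

end Transport

/-! ### From transport costs to distances on measures. -/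

section Distance

variable {d q : ℕ} {X : Set (Fin d → ℝ)}

/-- Independence of the representing cloud comes for free: clouds of the same measure are at
distance zero, so the triangle inequality lets one replace the other. -/
lemma isDistance_of_toMeasure {D : PointCloud X → PointCloud X → ℝ}
    (hzero : ∀ μ ν, D μ ν = 0 ↔ μ.toMeasure = ν.toMeasure) (hsymm : ∀ μ ν, D μ ν = D ν μ)
    (htri : ∀ μ ν κ, D μ κ ≤ D μ ν + D ν κ) : IsDistance D := by
  have hspec : ∀ x : DiscreteMeasures X, (Classical.choose x.2).toMeasure = x.1 := fun x =>
    Classical.choose_spec x.2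
  have hcongr : ∀ μ μ' ν : PointCloud X, μ.toMeasure = μ'.toMeasure → D μ ν ≤ D μ' ν :=
    fun μ μ' ν h => by
      have := htri μ μ' ν
      rwa [(hzero μ μ').2 h, zero_add] at this
  have hcongr' : ∀ μ μ' ν : PointCloud X, μ.toMeasure = μ'.toMeasure → D μ ν = D μ' ν :=
    fun μ μ' ν h => le_antisymm (hcongr _ _ _ h) (hcongr _ _ _ h.symm)
  refine ⟨{ dist := fun x y => D (Classical.choose x.2) (Classical.choose y.2)
            dist_self := fun x => (hzero _ _).2 rfl
            dist_comm := fun x y => hsymm _ _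
            dist_triangle := fun x y z => htri _ _ _
            eq_of_dist_eq_zero := fun {x y} h => ?_ }, fun μ ν => ?_⟩
  · refine Subtype.ext ?_
    rw [← hspec x, ← hspec y]
    exact (hzero _ _).1 h
  · change D (Classical.choose μ.toDiscrete.2) (Classical.choose ν.toDiscrete.2) = D μ ν
    rw [hcongr' _ μ _ (hspec μ.toDiscrete), hsymm, hcongr' _ ν _ (hspec ν.toDiscrete), hsymm]

lemma coupling_le_one {n m : ℕ} {a : Fin n → ℝ} {b : Fin m → ℝ} (ha : ∀ i, 0 ≤ a i)
    (hsum : ∑ i, a i = 1) {P : Matrix (Fin n) (Fin m) ℝ} (hP : P ∈ couplings a b)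
    (i : Fin n) (j : Fin m) : P i j ≤ 1 :=
  calc P i j ≤ ∑ j, P i j := Finset.single_le_sum (fun j _ => hP.1 i j) (Finset.mem_univ j)
    _ = a i := hP.2.1 i
    _ ≤ ∑ i, a i := Finset.single_le_sum (fun i _ => ha i) (Finset.mem_univ i)
    _ = 1 := hsum

lemma costMatrix_nonneg (p : ℝ) (μ ν : PointCloud X) (i : Fin μ.n) (j : Fin ν.n) :
    0 ≤ costMatrix p μ ν i j := by
  rw [costMatrix, Matrix.of_apply]
  exact Finset.sum_nonneg fun _ _ => Real.rpow_nonneg (abs_nonneg _) _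

lemma pairing_costMatrix_nonneg (p : ℝ) (μ ν : PointCloud X) {P : Matrix (Fin μ.n) (Fin ν.n) ℝ}
    (hP : P ∈ couplings μ.wt ν.wt) : 0 ≤ pairing (costMatrix p μ ν) P :=
  Finset.sum_nonneg fun i _ => Finset.sum_nonneg fun j _ =>
    mul_nonneg (costMatrix_nonneg p μ ν i j) (hP.1 i j)

lemma abs_pairing_costMatrix_le (p : ℝ) (μ ν : PointCloud X) {P : Matrix (Fin μ.n) (Fin ν.n) ℝ}
    (hP : P ∈ couplings μ.wt ν.wt) :
    |pairing (costMatrix p μ ν) P| ≤ ∑ i, ∑ j, costMatrix p μ ν i j := by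
  rw [abs_of_nonneg (pairing_costMatrix_nonneg p μ ν hP)]
  exact Finset.sum_le_sum fun i _ => Finset.sum_le_sum fun j _ =>
    mul_le_of_le_one_right (costMatrix_nonneg p μ ν i j)
      (coupling_le_one μ.wt_nonneg μ.sum_wt hP i j)

lemma wassersteinPow_le_pairing (p : ℝ) (μ ν : PointCloud X)
    {P : Matrix (Fin μ.n) (Fin ν.n) ℝ} (hP : P ∈ couplings μ.wt ν.wt) :
    wassersteinPow p μ ν ≤ pairing (costMatrix p μ ν) P := by
  refine csInf_le ⟨0, ?_⟩ ⟨P, hP, rfl⟩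
  rintro _ ⟨P', hP', rfl⟩
  exact pairing_costMatrix_nonneg p μ ν hP'

lemma costMatrix_eq_zero {p : ℝ} (hp : 1 < p) {μ ν : PointCloud X} {i : Fin μ.n} {j : Fin ν.n}
    (h : costMatrix p μ ν i j = 0) : μ.pt i = ν.pt j := by
  ext k
  rw [costMatrix, Matrix.of_apply] at h
  have := (Finset.sum_eq_zero_iff_of_nonneg
    fun k _ => Real.rpow_nonneg (abs_nonneg (μ.pt i k - ν.pt j k)) p).1 h k (Finset.mem_univ k)
  rw [Real.rpow_eq_zero (abs_nonneg _) (by linarith), abs_eq_zero, sub_eq_zero] at this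
  exact this

/-- A plan of zero cost charges only pairs with `x_i = y_j`, so expanding the two measures along
rows and columns gives the same sum. -/
lemma toMeasure_eq_of_pairing_eq_zero {p : ℝ} (hp : 1 < p) {μ ν : PointCloud X}
    {P : Matrix (Fin μ.n) (Fin ν.n) ℝ} (hP : P ∈ couplings μ.wt ν.wt)
    (h : pairing (costMatrix p μ ν) P = 0) : μ.toMeasure = ν.toMeasure := by
  have hnn : ∀ i j, 0 ≤ costMatrix p μ ν i j * P i j := fun i j =>
    mul_nonneg (costMatrix_nonneg p μ ν i j) (hP.1 i j)
  have hz : ∀ i j, costMatrix p μ ν i j * P i j = 0 := fun i j =>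
    (Finset.sum_eq_zero_iff_of_nonneg fun j _ => hnn i j).1
      ((Finset.sum_eq_zero_iff_of_nonneg fun i _ => Finset.sum_nonneg fun j _ => hnn i j).1 h i
        (Finset.mem_univ i)) j (Finset.mem_univ j)
  have hμ : μ.toMeasure = ∑ i, ∑ j, ENNReal.ofReal (P i j) • Measure.dirac (μ.pt i) := by
    refine Finset.sum_congr rfl fun i _ => ?_
    rw [← hP.2.1 i, ENNReal.ofReal_sum_of_nonneg fun j _ => hP.1 i j, Finset.sum_smul]
  have hν : ν.toMeasure = ∑ j, ∑ i, ENNReal.ofReal (P i j) • Measure.dirac (ν.pt j) := by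
    refine Finset.sum_congr rfl fun j _ => ?_
    rw [← hP.2.2 j, ENNReal.ofReal_sum_of_nonneg fun i _ => hP.1 i j, Finset.sum_smul]
  rw [hμ, hν, Finset.sum_comm]
  refine Finset.sum_congr rfl fun j _ => Finset.sum_congr rfl fun i _ => ?_
  rcases mul_eq_zero.1 (hz i j) with h0 | h0
  · rw [costMatrix_eq_zero hp h0]
  · simp [h0]

/-- The projected distribution function, hence the quantile function, depends only on the measure
and not on the cloud. -/
lemma weightCdf_eq_toMeasure (μ : PointCloud X) (f : (Fin d → ℝ) → ℝ) (x : ℝ) :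
    weightCdf μ.wt (fun i => f (μ.pt i)) x = (μ.toMeasure {y | f y ≤ x}).toReal := by
  have h : μ.toMeasure {y | f y ≤ x} =
      ENNReal.ofReal (weightCdf μ.wt (fun i => f (μ.pt i)) x) := by
    rw [weightCdf, ENNReal.ofReal_sum_of_nonneg]
    · rw [PointCloud.toMeasure, Measure.finsetSum_apply]
      refine Finset.sum_congr rfl fun i _ => ?_
      by_cases hi : f (μ.pt i) ≤ x <;> simp [hi]
    · intro i _
      split_ifs <;> simp [μ.wt_nonneg]
  rw [h, ENNReal.toReal_ofReal (weightCdf_nonneg μ.wt_nonneg x)]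

/-- The inverse of `f` on `X`, extended by zero, with values in `ℓ^p`. -/
def pointOfValue (p : ℝ) (X : Set (Fin d → ℝ)) (f : (Fin d → ℝ) → ℝ) (r : ℝ) :
    PiLp (ENNReal.ofReal p) fun _ : Fin d => ℝ :=
  open Classical in
  if r ∈ f '' X then WithLp.toLp _ (Function.invFunOn f X r) else 0

lemma pointOfValue_apply (p : ℝ) {f : (Fin d → ℝ) → ℝ} (hf : Set.InjOn f X) {x : Fin d → ℝ}
    (hx : x ∈ X) : pointOfValue p X f (f x) = WithLp.toLp _ x := by
  rw [pointOfValue, if_pos ⟨x, hx, rfl⟩, hf.leftInvOn_invFunOn hx]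

/-- Off the countable set `f '' X` the map is constant, so no regularity of `f` is involved. -/
lemma measurable_pointOfValue (p : ℝ) (hX : X.Countable) (f : (Fin d → ℝ) → ℝ) :
    Measurable (pointOfValue p X f) := by
  refine Measurable.measurable_of_countable_ne (f := fun _ => 0) measurable_const
    ((hX.image f).mono fun r hr => ?_)
  by_contra h
  exact hr (by rw [pointOfValue, if_neg h])

lemma enorm_toLp_sub_rpow {p : ℝ} (hp : 1 < p) (x y : Fin d → ℝ) :
    haveI : Fact (1 ≤ ENNReal.ofReal p) := ⟨by simpa using hp.le⟩
    ‖(WithLp.toLp (ENNReal.ofReal p) x - WithLp.toLp (ENNReal.ofReal p) y :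
      PiLp (ENNReal.ofReal p) fun _ : Fin d => ℝ)‖ₑ ^ p =
      ENNReal.ofReal (∑ k, |x k - y k| ^ p) := by
  have : Fact (1 ≤ ENNReal.ofReal p) := ⟨by simpa using hp.le⟩
  have hp0 : 0 < p := by linarith
  have hpr : (ENNReal.ofReal p).toReal = p := ENNReal.toReal_ofReal hp0.le
  rw [← ofReal_norm, ENNReal.ofReal_rpow_of_nonneg (norm_nonneg _) hp0.le,
    PiLp.norm_eq_sum (by rw [hpr]; exact hp0), hpr, ← Real.rpow_mul
      (Finset.sum_nonneg fun _ _ => Real.rpow_nonneg (norm_nonneg _) _), one_div,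
    inv_mul_cancel₀ hp0.ne', Real.rpow_one]
  simp

/-- The map `(0, 1] → X ⊆ ℓ^p` whose composition with `f` is the quantile function of `f_# μ`. -/
def quantilePoint (p : ℝ) (f : (Fin d → ℝ) → ℝ) (μ : PointCloud X) (u : Set.Ioc (0 : ℝ) 1) :
    PiLp (ENNReal.ofReal p) fun _ : Fin d => ℝ :=
  pointOfValue p X f (quantile μ.wt (fun i => f (μ.pt i)) u)

lemma measurable_quantilePoint (p : ℝ) (hX : X.Countable) (f : (Fin d → ℝ) → ℝ)
    (μ : PointCloud X) : Measurable (quantilePoint p f μ) :=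
  (measurable_pointOfValue p hX f).comp (measurable_quantile μ.wt_nonneg μ.sum_wt)

lemma quantilePoint_congr (p : ℝ) (f : (Fin d → ℝ) → ℝ) {μ ν : PointCloud X}
    (h : μ.toMeasure = ν.toMeasure) : quantilePoint p f μ = quantilePoint p f ν := by
  have : weightCdf μ.wt (fun i => f (μ.pt i)) = weightCdf ν.wt fun i => f (ν.pt i) := by
    ext x
    rw [weightCdf_eq_toMeasure, weightCdf_eq_toMeasure, h]
  ext1 u
  rw [quantilePoint, quantilePoint, quantile, quantile, this]

/-- The transport cost of an optimal plan for the projected problem is the `p`-th power of the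
`L^p` distance of the quantile maps. -/
lemma ofReal_rpow_pairing_eq_eLpNorm {p : ℝ} (hp : 1 < p) (hX : X.Countable)
    {φ : (Fin d → ℝ) → EuclideanSpace ℝ (Fin q) → ℝ} {θ : EuclideanSpace ℝ (Fin q)}
    (hinj : Set.InjOn (fun x => φ x θ) X) {μ ν : PointCloud X}
    {P : Matrix (Fin μ.n) (Fin ν.n) ℝ} (hP : IsPlan p φ μ ν θ P) :
    haveI : Fact (1 ≤ ENNReal.ofReal p) := ⟨by simpa using hp.le⟩
    ENNReal.ofReal (pairing (costMatrix p μ ν) P ^ (1 / p)) =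
      eLpNorm (quantilePoint p (fun x => φ x θ) μ - quantilePoint p (fun x => φ x θ) ν)
        (ENNReal.ofReal p) unitMeasure := by
  have : Fact (1 ≤ ENNReal.ofReal p) := ⟨by simpa using hp.le⟩
  have hp0 : 0 < p := by linarith
  set f : (Fin d → ℝ) → ℝ := fun x => φ x θ with hf
  -- The original cost in `ℝ^d`, written as a function of the two projected values so that it can be
  -- integrated against the law on the plane.
  set G : ℝ × ℝ → ENNReal := fun z => ‖pointOfValue p X f z.1 - pointOfValue p X f z.2‖ₑ ^ p
    with hG
  have hGm : Measurable G := by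
    have hg := measurable_pointOfValue p hX f
    exact (((hg.comp measurable_fst).sub (hg.comp measurable_snd)).enorm).pow_const p
  have hqm : Measurable fun u : Set.Ioc (0 : ℝ) 1 =>
      (quantile μ.wt (fun i => f (μ.pt i)) u, quantile ν.wt (fun j => f (ν.pt j)) u) :=
    (measurable_quantile μ.wt_nonneg μ.sum_wt).prodMk (measurable_quantile ν.wt_nonneg ν.sum_wt)
  have hlaw := sum_dirac_eq_map_quantile (s := fun i => f (μ.pt i)) (t := fun j => f (ν.pt j))
    μ.wt_nonneg μ.sum_wt ν.wt_nonneg ν.sum_wt hP.1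
    fun i k j l hij hkl hik => monotone_support_of_isMinOn hp hP.1 hP.2 hij hkl hik
  have hint : ENNReal.ofReal (pairing (costMatrix p μ ν) P) =
      ∫⁻ u, ‖quantilePoint p f μ u - quantilePoint p f ν u‖ₑ ^ p ∂unitMeasure := by
    have h1 : ∫⁻ u, ‖quantilePoint p f μ u - quantilePoint p f ν u‖ₑ ^ p ∂unitMeasure =
        ∫⁻ z, G z ∂(unitMeasure.map fun u : Set.Ioc (0 : ℝ) 1 =>
          (quantile μ.wt (fun i => f (μ.pt i)) u, quantile ν.wt (fun j => f (ν.pt j)) u)) := by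
      rw [lintegral_map hGm hqm]
      rfl
    rw [h1, ← hlaw, lintegral_finsetSum_measure, pairing, ENNReal.ofReal_sum_of_nonneg]
    · refine Finset.sum_congr rfl fun i _ => ?_
      rw [lintegral_finsetSum_measure, ENNReal.ofReal_sum_of_nonneg]
      · refine Finset.sum_congr rfl fun j _ => ?_
        rw [lintegral_smul_measure, lintegral_dirac, hG]
        simp only
        -- Injectivity recovers `x_i` and `y_j` from their projections.
        rw [pointOfValue_apply p hinj (μ.pt_mem i), pointOfValue_apply p hinj (ν.pt_mem j),
          enorm_toLp_sub_rpow hp, mul_comm, ENNReal.ofReal_mul (hP.1.1 i j)]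
        rfl
      · exact fun j _ => mul_nonneg (costMatrix_nonneg p μ ν i j) (hP.1.1 i j)
    · exact fun i _ => Finset.sum_nonneg fun j _ =>
        mul_nonneg (costMatrix_nonneg p μ ν i j) (hP.1.1 i j)
  rw [eLpNorm_eq_lintegral_rpow_enorm_toReal (by simpa using hp0) ENNReal.ofReal_ne_top,
    ENNReal.toReal_ofReal hp0.le, ← ENNReal.ofReal_rpow_of_nonneg
      (pairing_costMatrix_nonneg p μ ν hP.1) (by positivity), hint]
  rfl

variable {p : ℝ} {φ : (Fin d → ℝ) → EuclideanSpace ℝ (Fin q) → ℝ} {π : PlanFamily X q}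

lemma value_nonneg (hπ : IsPlanSelection p φ π) (μ ν : PointCloud X)
    (θ : EuclideanSpace ℝ (Fin q)) : 0 ≤ value p π μ ν θ :=
  pairing_costMatrix_nonneg p μ ν (hπ.isPlan μ ν θ).1

lemma abs_value_le (hπ : IsPlanSelection p φ π) (μ ν : PointCloud X)
    (θ : EuclideanSpace ℝ (Fin q)) : |value p π μ ν θ| ≤ ∑ i, ∑ j, costMatrix p μ ν i j :=
  abs_pairing_costMatrix_le p μ ν (hπ.isPlan μ ν θ).1

lemma aemeasurable_value (hπ : IsPlanSelection p φ π) (μ ν : PointCloud X) :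
    AEMeasurable (value p π μ ν) := by
  unfold value pairing
  refine Finset.aemeasurable_fun_sum _ fun i _ => Finset.aemeasurable_fun_sum _ fun j _ => ?_
  exact (hπ.aemeasurable μ ν i j).const_mul _

lemma integrable_value (hπ : IsPlanSelection p φ π) (μ ν : PointCloud X)
    (θ : EuclideanSpace ℝ (Fin q)) {ε : ℝ} (hε : 0 < ε) :
    Integrable (fun z => value p π μ ν (θ + ε • z)) (gaussian q) :=
  integrable_comp_add_smul (aemeasurable_value hπ μ ν) (abs_value_le hπ μ ν) θ hε.ne'

/-! ### Metric axioms at a parameter where `φ^θ` is injective on `X`. -/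

section Pointwise

variable (hp : 1 < p) (hX : X.Countable) (hπ : IsPlanSelection p φ π)
  {θ : EuclideanSpace ℝ (Fin q)} (hinj : Set.InjOn (fun x => φ x θ) X)

include hp hX hπ hinj

lemma value_eq_zero_iff (μ ν : PointCloud X) :
    value p π μ ν θ = 0 ↔ μ.toMeasure = ν.toMeasure := by
  refine ⟨toMeasure_eq_of_pairing_eq_zero hp (hπ.isPlan μ ν θ).1, fun h => ?_⟩
  have : Fact (1 ≤ ENNReal.ofReal p) := ⟨by simpa using hp.le⟩
  have h1 := ofReal_rpow_pairing_eq_eLpNorm hp hX hinj (hπ.isPlan μ ν θ)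
  rw [quantilePoint_congr p _ h, sub_self, eLpNorm_zero, ENNReal.ofReal_eq_zero] at h1
  have h2 := (Real.rpow_nonneg (value_nonneg hπ μ ν θ) (1 / p)).antisymm h1 |>.symm
  exact ((Real.rpow_eq_zero_iff_of_nonneg (value_nonneg hπ μ ν θ)).1 h2).1

lemma value_comm (μ ν : PointCloud X) : value p π μ ν θ = value p π ν μ θ := by
  have : Fact (1 ≤ ENNReal.ofReal p) := ⟨by simpa using hp.le⟩
  have h1 := ofReal_rpow_pairing_eq_eLpNorm hp hX hinj (hπ.isPlan μ ν θ)
  have h2 := ofReal_rpow_pairing_eq_eLpNorm hp hX hinj (hπ.isPlan ν μ θ)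
  change ENNReal.ofReal (value p π μ ν θ ^ (1 / p)) = _ at h1
  change ENNReal.ofReal (value p π ν μ θ ^ (1 / p)) = _ at h2
  rw [eLpNorm_sub_comm, ← h2, ENNReal.ofReal_eq_ofReal_iff
    (Real.rpow_nonneg (value_nonneg hπ μ ν θ) _) (Real.rpow_nonneg (value_nonneg hπ ν μ θ) _)] at h1
  exact (Real.rpow_left_inj (value_nonneg hπ μ ν θ) (value_nonneg hπ ν μ θ)
    (one_div_ne_zero (by linarith))).1 h1

lemma value_rpow_triangle (μ ν κ : PointCloud X) :
    value p π μ κ θ ^ (1 / p) ≤ value p π μ ν θ ^ (1 / p) + value p π ν κ θ ^ (1 / p) := by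
  have : Fact (1 ≤ ENNReal.ofReal p) := ⟨by simpa using hp.le⟩
  have hn : ∀ μ ν, 0 ≤ value p π μ ν θ ^ (1 / p) := fun μ ν =>
    Real.rpow_nonneg (value_nonneg hπ μ ν θ) _
  rw [← ENNReal.ofReal_le_ofReal_iff (add_nonneg (hn _ _) (hn _ _)),
    ENNReal.ofReal_add (hn _ _) (hn _ _)]
  unfold value
  rw [ofReal_rpow_pairing_eq_eLpNorm hp hX hinj (hπ.isPlan μ κ θ),
    ofReal_rpow_pairing_eq_eLpNorm hp hX hinj (hπ.isPlan μ ν θ),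
    ofReal_rpow_pairing_eq_eLpNorm hp hX hinj (hπ.isPlan ν κ θ),
    ← sub_add_sub_cancel _ (quantilePoint p (fun x => φ x θ) ν)]
  have hm := fun μ : PointCloud X =>
    (measurable_quantilePoint p hX (fun x => φ x θ) μ).aestronglyMeasurable (μ := unitMeasure)
  exact eLpNorm_add_le ((hm μ).sub (hm ν)) ((hm ν).sub (hm κ)) this.out

lemma isDistance_value : IsDistance fun μ ν : PointCloud X => value p π μ ν θ ^ (1 / p) := by
  refine isDistance_of_toMeasure (fun μ ν => ?_) (fun μ ν => ?_)
    (value_rpow_triangle hp hX hπ hinj)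
  · rw [Real.rpow_eq_zero (value_nonneg hπ μ ν θ) (one_div_ne_zero (by linarith)),
      value_eq_zero_iff hp hX hπ hinj]
  · rw [value_comm hp hX hπ hinj]

end Pointwise

/-! ### The smoothed distance as an `L^p` norm over the Gaussian. -/

lemma eLpNorm_rpow_one_div {Ω : Type*} [MeasurableSpace Ω] {γ : Measure Ω} (hp : 1 < p)
    {V : Ω → ℝ} (hV : ∀ z, 0 ≤ V z) (hint : Integrable V γ) :
    eLpNorm (fun z => V z ^ (1 / p)) (ENNReal.ofReal p) γ =
      ENNReal.ofReal ((∫ z, V z ∂γ) ^ (1 / p)) := by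
  have hp0 : 0 < p := by linarith
  rw [eLpNorm_eq_lintegral_rpow_enorm_toReal (by simpa using hp0) ENNReal.ofReal_ne_top,
    ENNReal.toReal_ofReal hp0.le, ← ENNReal.ofReal_rpow_of_nonneg (integral_nonneg hV)
      (by positivity), ofReal_integral_eq_lintegral_ofReal hint (Eventually.of_forall hV)]
  congr 2 with z
  rw [Real.enorm_of_nonneg (Real.rpow_nonneg (hV z) _),
    ENNReal.ofReal_rpow_of_nonneg (Real.rpow_nonneg (hV z) _) hp0.le, ← Real.rpow_mul (hV z),
    one_div, inv_mul_cancel₀ hp0.ne', Real.rpow_one]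

lemma isDistance_smoothValue (hp : 1 < p) (hX : X.Countable) (hπ : IsPlanSelection p φ π)
    (hinj : ∀ᵐ θ ∂(volume : Measure (EuclideanSpace ℝ (Fin q))), Set.InjOn (fun x => φ x θ) X)
    {ε : ℝ} (hε : 0 < ε) (θ : EuclideanSpace ℝ (Fin q)) :
    IsDistance fun μ ν : PointCloud X => smoothValue p π μ ν ε θ ^ (1 / p) := by
  have hinj' : ∀ᵐ z ∂(gaussian q), Set.InjOn (fun x => φ x (θ + ε • z)) X :=
    (quasiMeasurePreserving_add_smul θ hε.ne').ae hinj
  have hV := fun (μ ν : PointCloud X) (z : EuclideanSpace ℝ (Fin q)) =>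
    value_nonneg hπ μ ν (θ + ε • z)
  have hint := fun μ ν : PointCloud X => integrable_value hπ μ ν θ hε
  have hS := fun μ ν : PointCloud X => integral_nonneg (μ := gaussian q) (f := fun z => value p π μ ν (θ + ε • z)) (hV μ ν)
  refine isDistance_of_toMeasure (fun μ ν => ?_) (fun μ ν => ?_) (fun μ ν κ => ?_)
  · rw [smoothValue, Real.rpow_eq_zero (hS μ ν) (one_div_ne_zero (by linarith)),
      integral_eq_zero_iff_of_nonneg (hV μ ν) (hint μ ν)]
    constructor
    · intro h
      -- A single `z` with zero value and an injective projection already identifies the measures.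
      obtain ⟨z, hz, hz'⟩ := (hinj'.and h).exists
      exact (value_eq_zero_iff hp hX hπ hz μ ν).1 hz'
    · intro h
      filter_upwards [hinj'] with z hz
      exact (value_eq_zero_iff hp hX hπ hz μ ν).2 h
  · congr 1
    refine integral_congr_ae ?_
    filter_upwards [hinj'] with z hz
    exact value_comm hp hX hπ hz μ ν
  · have hn := fun μ ν : PointCloud X => Real.rpow_nonneg (hS μ ν) (1 / p)
    have hm : ∀ μ ν : PointCloud X, AEStronglyMeasurable
        (fun z => value p π μ ν (θ + ε • z) ^ (1 / p)) (gaussian q) := fun μ ν =>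
      ((hint μ ν).aestronglyMeasurable.aemeasurable.pow_const _).aestronglyMeasurable
    simp only [smoothValue]
    rw [← ENNReal.ofReal_le_ofReal_iff (add_nonneg (hn _ _) (hn _ _)),
      ENNReal.ofReal_add (hn _ _) (hn _ _), ← eLpNorm_rpow_one_div hp (hV μ κ) (hint μ κ),
      ← eLpNorm_rpow_one_div hp (hV μ ν) (hint μ ν),
      ← eLpNorm_rpow_one_div hp (hV ν κ) (hint ν κ)]
    have hone : (1 : ENNReal) ≤ ENNReal.ofReal p := by simpa using hp.le
    -- Minkowski over the Gaussian; the triangle inequality at almost every `z` supplies the rest.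
    have hadd := eLpNorm_add_le (hm μ ν) (hm ν κ) hone
    refine LE.le.trans ?_ hadd
    refine eLpNorm_mono_ae ?_
    filter_upwards [hinj'] with z hz
    have hr := fun μ ν : PointCloud X => Real.rpow_nonneg (hV μ ν z) (1 / p)
    rw [Pi.add_apply, Real.norm_of_nonneg (hr _ _), Real.norm_of_nonneg
      (add_nonneg (hr _ _) (hr _ _))]
    exact value_rpow_triangle hp hX hπ hz μ ν κ

/-! ### Admissibility of the averaged plan and a.e. continuity. -/

lemma integrable_plan (hπ : IsPlanSelection p φ π) (μ ν : PointCloud X)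
    (θ : EuclideanSpace ℝ (Fin q)) {ε : ℝ} (hε : 0 < ε) (i : Fin μ.n) (j : Fin ν.n) :
    Integrable (fun z => π μ ν (θ + ε • z) i j) (gaussian q) := by
  have hb : ∀ θ', |π μ ν θ' i j| ≤ 1 := fun θ' => by
    have h := (hπ.isPlan μ ν θ').1
    rw [abs_of_nonneg (h.1 i j)]
    exact coupling_le_one μ.wt_nonneg μ.sum_wt h i j
  have hm : AEMeasurable (fun θ' => π μ ν θ' i j) volume := hπ.aemeasurable μ ν i j
  exact integrable_comp_add_smul hm hb θ hε.ne'

lemma smoothPlan_mem_couplings (hπ : IsPlanSelection p φ π) (μ ν : PointCloud X)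
    (θ : EuclideanSpace ℝ (Fin q)) {ε : ℝ} (hε : 0 < ε) :
    smoothPlan π μ ν ε θ ∈ couplings μ.wt ν.wt := by
  have hc := fun z => (hπ.isPlan μ ν (θ + ε • z)).1
  refine ⟨fun i j => integral_nonneg fun z => (hc z).1 i j, fun i => ?_, fun j => ?_⟩
  · simp only [smoothPlan, Matrix.of_apply]
    rw [← integral_finsetSum _ fun j _ => integrable_plan hπ μ ν θ hε i j]
    simp [(hc _).2.1 i]
  · simp only [smoothPlan, Matrix.of_apply]
    rw [← integral_finsetSum _ fun i _ => integrable_plan hπ μ ν θ hε i j]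
    simp [(hc _).2.2 j]

lemma smoothValue_eq_pairing (hπ : IsPlanSelection p φ π) (μ ν : PointCloud X)
    (θ : EuclideanSpace ℝ (Fin q)) {ε : ℝ} (hε : 0 < ε) :
    smoothValue p π μ ν ε θ = pairing (costMatrix p μ ν) (smoothPlan π μ ν ε θ) := by
  have hi := fun i j => (integrable_plan hπ μ ν θ hε i j).const_mul (costMatrix p μ ν i j)
  simp only [smoothValue, value, pairing, smoothPlan, Matrix.of_apply]
  rw [integral_finsetSum _ fun i _ => integrable_finsetSum _ fun j _ => hi i j]
  refine Finset.sum_congr rfl fun i _ => ?_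
  rw [integral_finsetSum _ fun j _ => hi i j]
  exact Finset.sum_congr rfl fun j _ => integral_const_mul _ _

lemma ae_continuousAt_of_C1OffHausdorffNull {f : EuclideanSpace ℝ (Fin q) → ℝ}
    (hf : C1OffHausdorffNull f) : ∀ᵐ θ, ContinuousAt f θ := by
  obtain ⟨C, hC, hnull, hf⟩ := hf
  filter_upwards [show ∀ᵐ θ, θ ∈ C from volume_eq_zero_of_hausdorffMeasure_eq_zero hnull]
    with θ hθ
  exact hf.continuousOn.continuousAt (hC.mem_nhds hθ)

end Distance

end GSWP

end

/-! ### The main theorem. -/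

theorem proposition2 {d q : ℕ} (p : ℝ) (hp : 1 < p)
    (X : Set (Fin d → ℝ)) (hX : IsDiscrete X)
    (φ : (Fin d → ℝ) → EuclideanSpace ℝ (Fin q) → ℝ)
    (hφ : Continuous fun u : (Fin d → ℝ) × EuclideanSpace ℝ (Fin q) => φ u.1 u.2)
    (π : GSWP.PlanFamily X q) (hπ : GSWP.IsPlanSelection p φ π) :
    -- for every pair whose value function is regular:
    (∀ μ ν : GSWP.PointCloud X, GSWP.C1OffHausdorffNull (GSWP.value p π μ ν) →
      -- (1) admissibility (the expectations are well defined)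
      (∀ (ε : ℝ), 0 < ε → ∀ θ : EuclideanSpace ℝ (Fin q),
        (∀ i j, Integrable (fun z => π μ ν (θ + ε • z) i j) (GSWP.gaussian q)) ∧
        Integrable (fun z => GSWP.value p π μ ν (θ + ε • z)) (GSWP.gaussian q) ∧
        GSWP.smoothPlan π μ ν ε θ ∈ GSWP.couplings μ.wt ν.wt ∧
        GSWP.smoothValue p π μ ν ε θ =
          GSWP.pairing (GSWP.costMatrix p μ ν) (GSWP.smoothPlan π μ ν ε θ) ∧
        GSWP.wassersteinPow p μ ν ≤ GSWP.smoothValue p π μ ν ε θ) ∧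
      -- (2) differentiability
      (∀ (ε : ℝ), 0 < ε → ∀ θ : EuclideanSpace ℝ (Fin q),
        Integrable (fun z => GSWP.value p π μ ν (θ + ε • z) • z) (GSWP.gaussian q) ∧
        HasGradientAt (GSWP.smoothValue p π μ ν ε)
          (ε⁻¹ • ∫ z, GSWP.value p π μ ν (θ + ε • z) • z ∂(GSWP.gaussian q)) θ) ∧
      -- (3) consistency
      (∀ᵐ θ ∂(volume : Measure (EuclideanSpace ℝ (Fin q))),
        Tendsto (fun ε => GSWP.smoothValue p π μ ν ε θ) (𝓝[>] 0)
          (𝓝 (GSWP.value p π μ ν θ))) ∧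
      (∀ θ : EuclideanSpace ℝ (Fin q), DifferentiableAt ℝ (GSWP.value p π μ ν) θ →
        Tendsto (fun ε => gradient (GSWP.smoothValue p π μ ν ε) θ) (𝓝[>] 0)
          (𝓝 (gradient (GSWP.value p π μ ν) θ)))) ∧
    -- (4) distance
    (∀ θ : EuclideanSpace ℝ (Fin q), Set.InjOn (fun x => φ x θ) X →
      GSWP.IsDistance fun μ ν : GSWP.PointCloud X => GSWP.value p π μ ν θ ^ (1 / p)) ∧
    ((∀ᵐ θ ∂(volume : Measure (EuclideanSpace ℝ (Fin q))), Set.InjOn (fun x => φ x θ) X) →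
      ∀ (ε : ℝ), 0 < ε → ∀ θ : EuclideanSpace ℝ (Fin q),
        GSWP.IsDistance fun μ ν : GSWP.PointCloud X =>
          GSWP.smoothValue p π μ ν ε θ ^ (1 / p)) := by

  -- A subspace of `ℝ^d` is separable, and a separable discrete space is countable.
  have hXc : X.Countable := by
    have := hX.to_subtype
    exact Set.countable_coe_iff.1 (TopologicalSpace.separableSpace_iff_countable.1 inferInstance)
  refine ⟨fun μ ν hreg => ⟨fun ε hε θ => ?_, fun ε hε θ => ?_, ?_, fun θ hd => ?_⟩,
    fun θ hinj => GSWP.isDistance_value hp hXc hπ hinj,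
    fun hinj ε hε θ => GSWP.isDistance_smoothValue hp hXc hπ hinj hε θ⟩
  · refine ⟨GSWP.integrable_plan hπ μ ν θ hε, GSWP.integrable_value hπ μ ν θ hε,
      GSWP.smoothPlan_mem_couplings hπ μ ν θ hε, GSWP.smoothValue_eq_pairing hπ μ ν θ hε, ?_⟩
    rw [GSWP.smoothValue_eq_pairing hπ μ ν θ hε]
    exact GSWP.wassersteinPow_le_pairing p μ ν (GSWP.smoothPlan_mem_couplings hπ μ ν θ hε)
  · exact ⟨GSWP.integrable_comp_add_smul_smul (GSWP.aemeasurable_value hπ μ ν)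
      (GSWP.abs_value_le hπ μ ν) θ hε.ne',
      GSWP.hasGradientAt_gaussian_smoothing (GSWP.aemeasurable_value hπ μ ν)
      (GSWP.abs_value_le hπ μ ν) θ hε.ne'⟩
  · filter_upwards [GSWP.ae_continuousAt_of_C1OffHausdorffNull hreg] with θ hθ
    exact GSWP.tendsto_gaussian_smoothing (GSWP.aemeasurable_value hπ μ ν)
      (GSWP.abs_value_le hπ μ ν) hθ
  · exact GSWP.tendsto_gradient_gaussian_smoothing (GSWP.aemeasurable_value hπ μ ν)
      (GSWP.abs_value_le hπ μ ν) hd
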